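/- Let $n\ge 1$ and let $\bar X$ be a permutation of $[n]=\{1,\dots,n\}$, written as a word. For $p\in[0,1]$, let $X=X(\bar X)$ be the random permutation obtained by marking each element of $\bar X$ independently with probability $p$ and then permuting the marked elements uniformly at random among the positions that they occupy, the unmarked elements staying in place. Let $\lambda(X)$ be the total number of records (left-to-right maxima) of $X$. Then for every $c>0$ there is a constant $C>0$, depending only on $c$, such that for every sequence $p=p(n)\in[0,1]$ with $p\gg n^{-1}$ (that is, $np\to\infty$ as $n\to\infty$) and $1-p\ge c\,n^{-1/2}\log n$ for all large $n$, one has $$\max_{\bar X}\mathbb E[\lambda(X)]\le C\,(1-p)\sqrt{\frac np}$$ for all sufficiently large $n$, where the maximum is over all permutations $\bar X$ of $[n]$. In other words, $\max_{\bar X}\mathbb E[\lambda(X)]=O\bigl((1-p)\sqrt{n/p}\bigr)$. -/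

import Mathlib

namespace Records

/-- The number of records (left-to-right maxima) of a permutation `x` of `{0, …, n-1}`,
written as the word `x 0, x 1, …, x (n-1)`: the positions `k` whose entry exceeds all
entries to the left of it. -/
def numRecords {n : ℕ} (x : Equiv.Perm (Fin n)) : ℕ :=
  (Finset.univ.filter fun k : Fin n => ∀ j : Fin n, j < k → x j < x k).card

/-- The probability that exactly the elements at the positions in `S` are marked, when each
element is marked independently with probability `p`. -/
noncomputable def markProb {n : ℕ} (p : ℝ) (S : Finset (Fin n)) : ℝ :=
  ∏ i : Fin n, if i ∈ S then p else 1 - p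

/-- The permutation obtained from the word `xbar` by rearranging the entries at the marked
positions `S` among these positions according to `τ`; all other entries stay in place. -/
def rearrange {n : ℕ} (xbar : Equiv.Perm (Fin n)) (S : Finset (Fin n))
    (τ : Equiv.Perm {i : Fin n // i ∈ S}) : Equiv.Perm (Fin n) :=
  xbar * Equiv.Perm.ofSubtype τ

/-- The expected number of records of the random permutation `X` obtained from `xbar` by marking
its elements independently with probability `p`, and then permuting the marked elements
uniformly at random: first the average over the `|S|!` permutations of the marked set `S`, then
the average over `S`. -/
noncomputable def expectedRecords {n : ℕ} (p : ℝ) (xbar : Equiv.Perm (Fin n)) : ℝ :=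
  ∑ S : Finset (Fin n), markProb p S *
    ((∑ τ : Equiv.Perm {i : Fin n // i ∈ S}, (numRecords (rearrange xbar S τ) : ℝ)) /
      (S.card.factorial : ℝ))

/-- The maximum, over all starting permutations `xbar` of an `n`-element set, of the expected
number of records. -/
noncomputable def maxExpectedRecords (n : ℕ) (p : ℝ) : ℝ :=
  (Finset.univ : Finset (Equiv.Perm (Fin n))).sup' Finset.univ_nonempty
    fun xbar => expectedRecords p xbar

end Records

/-! Condition on the marked set `S` and treat records at marked and unmarked positions separately.
By symmetry, a marked position holds a record with probability at most the inverse of its rank in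
`S`, so these contribute at most `1 + log n`. The lower bound on `1 - p` makes this `O((1 - p) √(n /
p))`.

An unmarked `k` holds a record only if none of the `s` marked positions to its left receives one of
the `t` marked values above `x k`. This has probability at most `exp (-s t / m)` with `m = S.card`
(`card_avoiding_le_exp`). If `k` has `a` positions to its left and `b` values above its own, then
`s`, `t`, `m` are typically about `p a`, `p b`, `p n`, and Laplace transforms control the
exceptions. This leaves `(1 - p) exp (-p a b / (48 n))` plus small errors, the factor `1 - p` being
the cost of `k` being unmarked (`sum_markProb_unmarked_le`).

As `k` varies, `a` and `b` each run once through `0, …, n - 1`, whatever the starting word. Since `a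
b ≥ min(a, b)²`, the sum over `k` is at most two Gaussian sums of width of order `√(n / p)`. -/

namespace Records

/-! ### Uniform permutations: avoidance probabilities and symmetry -/

section Counting

variable {α : Type*} [Fintype α] [DecidableEq α]

/-- The permutations that map no element of `A` into `B`. -/
def avoiding (A B : Finset α) : Finset (Equiv.Perm α) :=
  Finset.univ.filter fun τ => ∀ j ∈ A, τ j ∉ B

theorem card_filter_avoiding_swap (A B : Finset α) {x y : α} (hx : x ∉ A) (hy : y ∉ A) :
    ((avoiding A B).filter fun τ => τ x ∈ B).card =
      ((avoiding A B).filter fun τ => τ y ∈ B).card := by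
  have key : ∀ j ∈ A, Equiv.swap x y j = j := fun j hj =>
    Equiv.swap_apply_of_ne_of_ne (fun h => hx (h ▸ hj)) (fun h => hy (h ▸ hj))
  refine Finset.card_bij' (fun τ _ => τ * Equiv.swap x y) (fun τ _ => τ * Equiv.swap x y)
    ?_ ?_ ?_ ?_
  · intro τ hτ
    simp only [avoiding, Finset.mem_filter, Finset.mem_univ, true_and, Equiv.Perm.mul_apply,
      Equiv.swap_apply_right] at hτ ⊢
    exact ⟨fun j hj => by rw [key j hj]; exact hτ.1 j hj, hτ.2⟩
  · intro τ hτ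
    simp only [avoiding, Finset.mem_filter, Finset.mem_univ, true_and, Equiv.Perm.mul_apply,
      Equiv.swap_apply_left] at hτ ⊢
    exact ⟨fun j hj => by rw [key j hj]; exact hτ.1 j hj, hτ.2⟩
  · intro τ _; simp [mul_assoc]
  · intro τ _; simp [mul_assoc]

/-- If `τ` avoids `B` on `A`, all `B.card` preimages of `B` lie outside `A`. Double counting pairs
`(τ, y)` with `τ y ∈ B` and using symmetry in `y ∉ A`, the conditional probability of `τ x ∈ B` is
at least `B.card / Fintype.card α`. -/
theorem card_mul_card_avoiding_le (A B : Finset α) {x : α} (hx : x ∉ A) :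
    B.card * (avoiding A B).card ≤
      Fintype.card α * ((avoiding A B).filter fun τ => τ x ∈ B).card := by
  calc B.card * (avoiding A B).card
      = ∑ τ ∈ avoiding A B, (Aᶜ.filter fun y => τ y ∈ B).card := by
        rw [mul_comm, ← smul_eq_mul, ← Finset.sum_const]
        refine Finset.sum_congr rfl fun τ hτ => ?_
        refine Finset.card_bij' (fun b _ => τ.symm b) (fun y _ => τ y) ?_ ?_ ?_ ?_
        · intro b hb
          simp only [avoiding, Finset.mem_filter, Finset.mem_univ, true_and] at hτ
          simp only [Finset.mem_filter, Finset.mem_compl, Equiv.apply_symm_apply, hb, and_true]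
          intro h
          exact hτ _ h (by simpa using hb)
        · intro y hy
          exact (Finset.mem_filter.1 hy).2
        · intro b _; simp
        · intro y _; simp
    _ = ∑ y ∈ Aᶜ, ((avoiding A B).filter fun τ => τ y ∈ B).card := by
        simp only [Finset.card_filter]
        exact Finset.sum_comm
    _ = ∑ _y ∈ Aᶜ, ((avoiding A B).filter fun τ => τ x ∈ B).card :=
        Finset.sum_congr rfl fun y hy =>
          card_filter_avoiding_swap A B (Finset.mem_compl.1 hy) hx
    _ = Aᶜ.card * ((avoiding A B).filter fun τ => τ x ∈ B).card := by
        rw [Finset.sum_const, smul_eq_mul]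
    _ ≤ _ := Nat.mul_le_mul_right _ (Finset.card_le_univ _)

theorem card_avoiding_le_pow (A B : Finset α) :
    ((avoiding A B).card : ℝ) ≤
      (1 - (B.card : ℝ) / Fintype.card α) ^ A.card * (Fintype.card α).factorial := by
  induction A using Finset.induction_on with
  | empty => simp [avoiding, Fintype.card_perm]
  | insert x A hx ih =>
    have hpos : (0 : ℝ) < Fintype.card α := by
      exact_mod_cast Fintype.card_pos_iff.2 ⟨x⟩
    have hB : (B.card : ℝ) / Fintype.card α ≤ 1 :=
      (div_le_one hpos).2 (by exact_mod_cast Finset.card_le_univ B)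
    have hsplit : (avoiding (insert x A) B).card +
        ((avoiding A B).filter fun τ => τ x ∈ B).card = (avoiding A B).card := by
      rw [← Finset.card_filter_add_card_filter_not (s := avoiding A B) (fun τ => τ x ∈ B), add_comm]
      congr 2
      ext τ
      simp [avoiding, and_comm]
    have hle : (B.card : ℝ) / Fintype.card α * (avoiding A B).card ≤
        ((avoiding A B).filter fun τ => τ x ∈ B).card := by
      rw [div_mul_eq_mul_div, div_le_iff₀ hpos, mul_comm _ (Fintype.card α : ℝ)]
      exact_mod_cast card_mul_card_avoiding_le A B hx
    have hsplit' : ((avoiding (insert x A) B).card : ℝ) +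
        ((avoiding A B).filter fun τ => τ x ∈ B).card = (avoiding A B).card := by
      exact_mod_cast hsplit
    calc ((avoiding (insert x A) B).card : ℝ)
        ≤ (1 - (B.card : ℝ) / Fintype.card α) * (avoiding A B).card := by linarith
      _ ≤ (1 - (B.card : ℝ) / Fintype.card α) *
          ((1 - (B.card : ℝ) / Fintype.card α) ^ A.card * (Fintype.card α).factorial) :=
          mul_le_mul_of_nonneg_left ih (by linarith)
      _ = _ := by rw [Finset.card_insert_of_notMem hx, pow_succ]; ring

theorem card_avoiding_le_exp (A B : Finset α) :
    ((avoiding A B).card : ℝ) ≤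
      Real.exp (-((A.card : ℝ) * B.card / Fintype.card α)) * (Fintype.card α).factorial := by
  refine (card_avoiding_le_pow A B).trans (mul_le_mul_of_nonneg_right ?_ (by positivity))
  have hB : (B.card : ℝ) / Fintype.card α ≤ 1 :=
    div_le_one_of_le₀ (by exact_mod_cast Finset.card_le_univ B) (by positivity)
  calc (1 - (B.card : ℝ) / Fintype.card α) ^ A.card
      ≤ Real.exp (-((B.card : ℝ) / Fintype.card α)) ^ A.card :=
        pow_le_pow_left₀ (by linarith) (Real.one_sub_le_exp_neg _) _
    _ = _ := by rw [← Real.exp_nat_mul]; congr 1; ring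

/-- By symmetry, each element of `J` is equally likely to be mapped to the strict maximum. -/
theorem card_mul_card_isMax_le {β : Type*} [LinearOrder β] (f : α → β)
    (J : Finset α) {k : α} (hk : k ∈ J) :
    J.card * (Finset.univ.filter fun τ : Equiv.Perm α =>
      ∀ j ∈ J, j ≠ k → f (τ j) < f (τ k)).card ≤ (Fintype.card α).factorial := by
  set E : α → Finset (Equiv.Perm α) := fun i => Finset.univ.filter fun τ : Equiv.Perm α =>
      ∀ j ∈ J, j ≠ i → f (τ j) < f (τ i) with hE
  have hcard : ∀ i ∈ J, (E k).card ≤ (E i).card := by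
    intro i hi
    refine Finset.card_le_card_of_injOn (fun τ => τ * Equiv.swap i k) ?_
      (fun a _ b _ h => mul_right_cancel h)
    intro τ hτ
    simp only [hE, Finset.coe_filter, Finset.mem_univ, true_and, Set.mem_ofPred_eq,
      Equiv.Perm.mul_apply, Equiv.swap_apply_left] at hτ ⊢
    intro j hj hji
    refine hτ _ ?_ ?_
    · rw [Equiv.swap_apply_def]; split_ifs <;> assumption
    · intro h
      exact hji ((Equiv.swap i k).injective (h.trans (Equiv.swap_apply_left i k).symm))
  have hdisj : Set.PairwiseDisjoint (J : Set α) E := by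
    intro i hi i' hi' hne
    refine Finset.disjoint_left.2 fun τ h h' => ?_
    simp only [hE, Finset.mem_filter, Finset.mem_univ, true_and] at h h'
    exact lt_asymm (h i' hi' hne.symm) (h' i hi hne)
  calc J.card * (E k).card = ∑ _i ∈ J, (E k).card := by rw [Finset.sum_const, smul_eq_mul]
    _ ≤ ∑ i ∈ J, (E i).card := Finset.sum_le_sum hcard
    _ = (J.biUnion E).card := (Finset.card_biUnion hdisj).symm
    _ ≤ Fintype.card (Equiv.Perm α) := Finset.card_le_univ _
    _ = _ := Fintype.card_perm

end Counting

/-! ### Record probabilities for a fixed marked set -/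

/-- The ranks of the elements of `S` are `1, …, S.card`; adding a new maximum leaves the earlier
ranks unchanged. -/
theorem sum_inv_card_filter_le {α : Type*} [LinearOrder α] (S : Finset α) :
    ∑ k ∈ S, ((S.filter (· ≤ k)).card : ℝ)⁻¹ = (harmonic S.card : ℝ) := by
  induction S using Finset.induction_on_max with
  | empty => simp
  | insert a S ha ih =>
    have haS : a ∉ S := fun h => lt_irrefl _ (ha a h)
    have hfa : (insert a S).filter (· ≤ a) = insert a S :=
      Finset.filter_true_of_mem fun x hx => by
        rcases Finset.mem_insert.1 hx with rfl | hx
        exacts [le_rfl, (ha x hx).le]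
    have hfk : ∀ k ∈ S, (insert a S).filter (· ≤ k) = S.filter (· ≤ k) := fun k hk => by
      rw [Finset.filter_insert, if_neg (ha k hk).not_ge]
    rw [Finset.sum_insert haS, hfa, Finset.card_insert_of_notMem haS, harmonic_succ,
      Finset.sum_congr rfl fun k hk => by rw [hfk k hk], ih]
    push_cast
    ring

variable {n : ℕ}

/-- The position `k` holds a record of `x`. -/
def IsRecord (x : Equiv.Perm (Fin n)) (k : Fin n) : Prop := ∀ j : Fin n, j < k → x j < x k

instance (x : Equiv.Perm (Fin n)) (k : Fin n) : Decidable (IsRecord x k) :=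
  inferInstanceAs (Decidable (∀ j : Fin n, j < k → x j < x k))

theorem rearrange_apply_coe (x : Equiv.Perm (Fin n)) (S : Finset (Fin n))
    (τ : Equiv.Perm {i : Fin n // i ∈ S}) (j : {i : Fin n // i ∈ S}) :
    rearrange x S τ j = x (τ j) := by
  simp [rearrange]

theorem rearrange_apply_of_notMem (x : Equiv.Perm (Fin n)) (S : Finset (Fin n))
    (τ : Equiv.Perm {i : Fin n // i ∈ S}) {k : Fin n} (hk : k ∉ S) :
    rearrange x S τ k = x k := by
  simp [rearrange, Equiv.Perm.ofSubtype_apply_of_not_mem τ hk]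

theorem sum_numRecords_rearrange (x : Equiv.Perm (Fin n)) (S : Finset (Fin n)) :
    ∑ τ : Equiv.Perm {i : Fin n // i ∈ S}, (numRecords (rearrange x S τ) : ℝ) =
      ∑ k : Fin n, ((Finset.univ.filter fun τ : Equiv.Perm {i : Fin n // i ∈ S} =>
        IsRecord (rearrange x S τ) k).card : ℝ) := by
  have h : ∀ y : Equiv.Perm (Fin n),
      numRecords y = (Finset.univ.filter fun k : Fin n => IsRecord y k).card := fun y => rfl
  simp only [h, Finset.card_filter]
  push_cast
  exact Finset.sum_comm

theorem card_filter_subtype (S : Finset (Fin n)) (P : Fin n → Prop) [DecidablePred P] :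
    (Finset.univ.filter fun j : {i : Fin n // i ∈ S} => P j).card = (S.filter P).card := by
  refine Finset.card_bij (fun j _ => j.1) ?_ ?_ ?_
  · intro j hj
    exact Finset.mem_filter.2 ⟨j.2, (Finset.mem_filter.1 hj).2⟩
  · intro i _ j _ h
    exact Subtype.ext h
  · intro b hb
    obtain ⟨h1, h2⟩ := Finset.mem_filter.1 hb
    exact ⟨⟨b, h1⟩, by simpa using h2, rfl⟩

theorem card_isRecord_marked_le (x : Equiv.Perm (Fin n)) (S : Finset (Fin n)) {k : Fin n}
    (hk : k ∈ S) :
    ((Finset.univ.filter fun τ : Equiv.Perm {i : Fin n // i ∈ S} =>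
        IsRecord (rearrange x S τ) k).card : ℝ) / (S.card.factorial : ℝ) ≤
      ((S.filter (· ≤ k)).card : ℝ)⁻¹ := by
  have hJ : (0 : ℝ) < (S.filter (· ≤ k)).card := by
    have : k ∈ S.filter (· ≤ k) := Finset.mem_filter.2 ⟨hk, le_rfl⟩
    exact_mod_cast Finset.card_pos.2 ⟨k, this⟩
  have h := card_mul_card_isMax_le (fun j : {i : Fin n // i ∈ S} => x j)
    (Finset.univ.filter fun j : {i : Fin n // i ∈ S} => j.1 ≤ k) (k := ⟨k, hk⟩) (by simp)
  rw [card_filter_subtype S (· ≤ k), Fintype.card_coe] at h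
  refine le_trans (div_le_div_of_nonneg_right (Nat.cast_le.2 (Finset.card_le_card
    (Finset.monotone_filter_right _ fun τ _ hτ j hj hjk => ?_))) (by positivity))
    (b := ((Finset.univ.filter fun τ : Equiv.Perm {i : Fin n // i ∈ S} =>
      ∀ j ∈ Finset.univ.filter fun j : {i : Fin n // i ∈ S} => j.1 ≤ k,
        j ≠ ⟨k, hk⟩ → x (τ j) < x (τ ⟨k, hk⟩)).card : ℝ) / (S.card.factorial : ℝ)) ?_
  · have h1 : j.1 < k := lt_of_le_of_ne (Finset.mem_filter.1 hj).2 fun h => hjk (Subtype.ext h)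
    have h2 := hτ j.1 h1
    rwa [rearrange_apply_coe, rearrange_apply_coe x S τ ⟨k, hk⟩] at h2
  · rw [div_le_iff₀ (by positivity), inv_mul_eq_div, le_div_iff₀ hJ, mul_comm]
    exact_mod_cast h

theorem card_isRecord_unmarked_le (x : Equiv.Perm (Fin n)) (S : Finset (Fin n)) {k : Fin n}
    (hk : k ∉ S) :
    ((Finset.univ.filter fun τ : Equiv.Perm {i : Fin n // i ∈ S} =>
        IsRecord (rearrange x S τ) k).card : ℝ) / (S.card.factorial : ℝ) ≤
      Real.exp (-(((S.filter (· < k)).card : ℝ) * (S.filter (x k < x ·)).card / S.card)) := by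
  have h := card_avoiding_le_exp
    (Finset.univ.filter fun j : {i : Fin n // i ∈ S} => j.1 < k)
    (Finset.univ.filter fun j : {i : Fin n // i ∈ S} => x k < x j.1)
  rw [card_filter_subtype S (· < k), card_filter_subtype S (x k < x ·), Fintype.card_coe] at h
  rw [div_le_iff₀ (by positivity)]
  refine le_trans ?_ h
  refine Nat.cast_le.2 (Finset.card_le_card ?_)
  refine Finset.monotone_filter_right _ fun τ _ hτ j hj hjB => ?_
  have h2 := hτ j.1 (Finset.mem_filter.1 hj).2
  rw [rearrange_apply_coe, rearrange_apply_of_notMem x S τ hk] at h2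
  exact lt_asymm h2 (Finset.mem_filter.1 hjB).2

/-! ### Averaging over the marked set -/

/-- Independence of the marks: the expectation of a product of weights factorises over the
positions. -/
theorem sum_markProb_mul_prod (p : ℝ) (w : Fin n → ℝ) :
    ∑ S : Finset (Fin n), markProb p S * ∏ i ∈ S, w i = ∏ i, (p * w i + (1 - p)) := by
  rw [Finset.prod_add, Finset.powerset_univ]
  refine Finset.sum_congr rfl fun S _ => ?_
  rw [markProb, ← Finset.prod_mul_prod_compl S, Finset.prod_mul_distrib,
    Finset.prod_congr rfl fun i hi => if_pos hi,
    Finset.prod_congr (s₁ := Sᶜ) rfl fun i hi => if_neg (Finset.mem_compl.1 hi),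
    Finset.compl_eq_univ_sdiff]
  ring

theorem sum_markProb (p : ℝ) : ∑ S : Finset (Fin n), markProb p S = 1 := by
  simpa using sum_markProb_mul_prod (n := n) p fun _ => 1

theorem markProb_nonneg {p : ℝ} (hp : p ∈ Set.Icc (0 : ℝ) 1) (S : Finset (Fin n)) :
    0 ≤ markProb p S :=
  Finset.prod_nonneg fun i _ => by
    split_ifs
    exacts [hp.1, sub_nonneg.2 hp.2]

/-- The Laplace transform of the number of marked elements satisfying `P`, restricted to the
event that `k` is unmarked. -/
theorem sum_markProb_exp_le {p : ℝ} (hp : p ∈ Set.Icc (0 : ℝ) 1) (k : Fin n)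
    (P : Fin n → Prop) [DecidablePred P] (hk : ¬ P k) (r : ℝ) :
    ∑ S : Finset (Fin n), markProb p S *
        (if k ∈ S then 0 else Real.exp (r * (S.filter P).card)) ≤
      (1 - p) * Real.exp (p * (Real.exp r - 1) * (Finset.univ.filter P).card) := by
  -- The zero weight at `k` encodes the event that `k` is unmarked, so the whole summand becomes a
  -- product over `S`.
  set w : Fin n → ℝ := fun i => if i = k then 0 else if P i then Real.exp r else 1 with hw
  have hprod : ∀ S : Finset (Fin n),
      (if k ∈ S then 0 else Real.exp (r * (S.filter P).card)) = ∏ i ∈ S, w i := by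
    intro S
    split_ifs with h
    · exact (Finset.prod_eq_zero h (by simp [hw])).symm
    · have : ∏ i ∈ S, w i = ∏ i ∈ S, if P i then Real.exp r else 1 :=
        Finset.prod_congr rfl fun i hi => if_neg fun e : i = k => h (e ▸ hi)
      rw [this, ← Finset.prod_filter, Finset.prod_const, ← Real.exp_nat_mul, mul_comm]
  simp only [hprod]
  rw [sum_markProb_mul_prod, ← Finset.mul_prod_erase _ _ (Finset.mem_univ k)]
  have h0 : p * w k + (1 - p) = 1 - p := by simp [hw]
  rw [h0]
  refine mul_le_mul_of_nonneg_left ?_ (sub_nonneg.2 hp.2)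
  have hfac : ∀ i ∈ Finset.univ.erase k, p * w i + (1 - p) =
      if P i then p * Real.exp r + (1 - p) else 1 := by
    intro i hi
    have : i ≠ k := Finset.ne_of_mem_erase hi
    simp only [hw, if_neg this]
    split_ifs <;> ring
  rw [Finset.prod_congr rfl hfac, ← Finset.prod_filter, Finset.prod_const]
  have hcard : (Finset.univ.erase k).filter P = Finset.univ.filter P := by
    ext i
    simp only [Finset.mem_filter, Finset.mem_erase, Finset.mem_univ, and_true, true_and]
    exact ⟨fun h => h.2, fun h => ⟨fun e => hk (e ▸ h), h⟩⟩
  rw [hcard]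
  calc (p * Real.exp r + (1 - p)) ^ (Finset.univ.filter P).card
      ≤ Real.exp (p * (Real.exp r - 1)) ^ (Finset.univ.filter P).card := by
        refine pow_le_pow_left₀ ?_ ?_ _
        · have := mul_nonneg hp.1 (Real.exp_pos r).le
          linarith [hp.2]
        · have := Real.add_one_le_exp (p * (Real.exp r - 1))
          linarith
    _ = _ := by rw [← Real.exp_nat_mul]; congr 1; ring

theorem expectedRecords_nonneg {p : ℝ} (hp : p ∈ Set.Icc (0 : ℝ) 1) (x : Equiv.Perm (Fin n)) :
    0 ≤ expectedRecords p x :=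
  Finset.sum_nonneg fun S _ => mul_nonneg (markProb_nonneg hp S) (by positivity)

/-- The records at marked positions contribute at most a harmonic number. -/
theorem expectedRecords_le {p : ℝ} (hp : p ∈ Set.Icc (0 : ℝ) 1) (x : Equiv.Perm (Fin n)) :
    expectedRecords p x ≤ (1 + Real.log n) +
      ∑ k : Fin n, ∑ S : Finset (Fin n), markProb p S * (if k ∈ S then 0 else
        Real.exp (-(((S.filter (· < k)).card : ℝ) * (S.filter (x k < x ·)).card / S.card))) := by
  have hlog : 1 + Real.log n = ∑ S : Finset (Fin n), markProb p S * (1 + Real.log n) := by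
    rw [← Finset.sum_mul, sum_markProb, one_mul]
  rw [Finset.sum_comm, hlog, ← Finset.sum_add_distrib]
  refine Finset.sum_le_sum fun S _ => ?_
  rw [← Finset.mul_sum, ← mul_add]
  refine mul_le_mul_of_nonneg_left ?_ (markProb_nonneg hp S)
  rw [sum_numRecords_rearrange, Finset.sum_div]
  have hH : ∑ k ∈ S, ((S.filter (· ≤ k)).card : ℝ)⁻¹ ≤ 1 + Real.log n := by
    rw [sum_inv_card_filter_le]
    refine (harmonic_le_one_add_log _).trans (add_le_add_right ?_ _)
    rcases Nat.eq_zero_or_pos S.card with h | h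
    · simpa [h] using Real.log_natCast_nonneg n
    · refine Real.log_le_log (by exact_mod_cast h) ?_
      exact_mod_cast (Finset.card_le_univ S).trans_eq (Fintype.card_fin n)
  refine le_trans ?_ (add_le_add hH le_rfl)
  rw [← Finset.univ_inter S, ← Finset.sum_ite_mem, Finset.univ_inter, ← Finset.sum_add_distrib]
  refine Finset.sum_le_sum fun k _ => ?_
  split_ifs with h
  · simpa using card_isRecord_marked_le x S h
  · simpa using card_isRecord_unmarked_le x S h

/-! ### Replacing the random counts by their means -/

/-- If `s ≥ p a / 4`, `t ≥ p b / 4` and `m ≤ 3 p N`, the first term suffices, with `48 = 4 · 4 · 3`.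
Otherwise one of the last three exponentials already dominates. Each of these is linear in one count
in the exponent, so its mean is a Laplace transform. -/
theorem exp_neg_mul_div_le {p N a b s t m : ℝ} (hp : 0 < p) (hN : 0 < N) (ha : 0 ≤ a)
    (hb : 0 ≤ b) (hs : 0 ≤ s) (hm : 0 ≤ m) (hsm : s ≤ m) :
    Real.exp (-(s * t / m)) ≤ Real.exp (-(p / (48 * N) * (a * b))) +
      Real.exp (p * a / 4 - s) + Real.exp (p * b / 4 - t) + Real.exp (m - 3 * p * N) := by
  have h1 := Real.exp_pos (-(p / (48 * N) * (a * b)))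
  have h2 := Real.exp_pos (p * a / 4 - s)
  have h3 := Real.exp_pos (p * b / 4 - t)
  have h4 := Real.exp_pos (m - 3 * p * N)
  by_cases ht : t < p * b / 4
  · have h5 : 1 ≤ Real.exp (p * b / 4 - t) := Real.one_le_exp (by linarith)
    by_cases ht0 : 0 ≤ t
    · have : Real.exp (-(s * t / m)) ≤ 1 := Real.exp_le_one_iff.2 (neg_nonpos.2 (by positivity))
      linarith
    -- Here `t < 0`, so `-(s t / m) ≤ -t`.
    · have h6 : s / m ≤ 1 := div_le_one_of_le₀ hsm hm
      have : Real.exp (-(s * t / m)) ≤ Real.exp (p * b / 4 - t) := by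
        refine Real.exp_le_exp.2 ?_
        have h7 : s * t / m = (s / m) * t := by ring
        have h8 : 0 ≤ p * b / 4 := by positivity
        rw [h7]
        nlinarith
      linarith
  have ht' : p * b / 4 ≤ t := not_lt.1 ht
  have ht0 : 0 ≤ t := le_trans (by positivity) ht'
  have hle1 : Real.exp (-(s * t / m)) ≤ 1 := Real.exp_le_one_iff.2 (neg_nonpos.2 (by positivity))
  by_cases hs' : s < p * a / 4
  · have : 1 ≤ Real.exp (p * a / 4 - s) := Real.one_le_exp (by linarith)
    linarith
  by_cases hm' : 3 * p * N < m
  · have : 1 ≤ Real.exp (m - 3 * p * N) := Real.one_le_exp (by linarith)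
    linarith
  push Not at hs' hm'
  suffices h : p / (48 * N) * (a * b) ≤ s * t / m by
    have : Real.exp (-(s * t / m)) ≤ Real.exp (-(p / (48 * N) * (a * b))) :=
      Real.exp_le_exp.2 (neg_le_neg h)
    linarith
  rcases hm.eq_or_lt with rfl | hm0
  · have hs0 : s = 0 := le_antisymm hsm hs
    have ha0 : a = 0 := by nlinarith
    simp [ha0]
  calc p / (48 * N) * (a * b) = (p * a / 4) * (p * b / 4) / (3 * p * N) := by
        field_simp; ring
    _ ≤ s * t / (3 * p * N) := by gcongr
    _ ≤ s * t / m := by gcongr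

theorem card_filter_apply_lt {n : ℕ} (x : Equiv.Perm (Fin n)) (k : Fin n) :
    (Finset.univ.filter (x k < x ·)).card = ((x k).rev : ℕ) := by
  have : (Finset.univ.filter (x k < x ·)) = (Finset.Ioi (x k)).map x.symm.toEmbedding := by
    ext i; simp
  rw [this, Finset.card_map, Fin.card_Ioi, Fin.val_rev]
  omega

theorem sum_markProb_unmarked_le {n : ℕ} {p : ℝ} (hp : p ∈ Set.Icc (0 : ℝ) 1) (hp0 : 0 < p)
    (x : Equiv.Perm (Fin n)) (k : Fin n) :
    ∑ S : Finset (Fin n), markProb p S * (if k ∈ S then 0 else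
        Real.exp (-(((S.filter (· < k)).card : ℝ) * (S.filter (x k < x ·)).card / S.card))) ≤
      (1 - p) * (Real.exp (-(p / (48 * n) * ((k : ℕ) * ((x k).rev : ℕ)))) +
        Real.exp (-(p / 4 * (k : ℕ))) + Real.exp (-(p / 4 * ((x k).rev : ℕ))) +
        Real.exp (-(p * n))) := by
  have hn : (0 : ℝ) < n := by exact_mod_cast k.pos
  have hq : 0 ≤ 1 - p := sub_nonneg.2 hp.2
  -- Four Laplace bounds, one per term of `exp_neg_mul_div_le`; the first merely bounds the
  -- probability that `k` is unmarked. The predicate must fail at `k`, so the size of `S` is counted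
  -- through `(· ≠ k)`, which loses nothing when `k ∉ S`. The margins come from `exp (-1) - 1 <
  -- -1/2` against `1/4`, and `exp 1 - 1 < 2` against `3`.
  set u : ℝ := Real.exp (-(p / (48 * n) * ((k : ℕ) * ((x k).rev : ℕ)))) with hu
  have e1 := sum_markProb_exp_le hp k (fun _ => False) (by simp) 0
  have e2 := sum_markProb_exp_le hp k (· < k) (by simp) (-1)
  have e3 := sum_markProb_exp_le hp k (x k < x ·) (by simp) (-1)
  have e4 := sum_markProb_exp_le hp k (· ≠ k) (by simp) 1
  have hexp := Real.exp_neg_one_lt_half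
  have hexp1 := Real.exp_one_lt_d9
  have cA : (Finset.univ.filter (· < k)).card = (k : ℕ) := by
    rw [Finset.filter_gt_eq_Iio, Fin.card_Iio]
  have cC : ((Finset.univ.filter (· ≠ k)).card : ℝ) ≤ n := by
    exact_mod_cast (Finset.card_le_univ _).trans_eq (Fintype.card_fin n)
  rw [cA] at e2
  rw [card_filter_apply_lt] at e3
  have f : ∀ j : ℕ, Real.exp (p * j / 4) * ((1 - p) * Real.exp (p * (Real.exp (-1) - 1) * j)) ≤
      (1 - p) * Real.exp (-(p / 4 * j)) := by
    intro j
    rw [mul_left_comm, ← Real.exp_add]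
    refine mul_le_mul_of_nonneg_left (Real.exp_le_exp.2 ?_) hq
    have : 0 ≤ p * j := by positivity
    nlinarith
  have f4 : Real.exp (-(3 * p * n)) *
      ((1 - p) * Real.exp (p * (Real.exp 1 - 1) * (Finset.univ.filter (· ≠ k)).card)) ≤
      (1 - p) * Real.exp (-(p * n)) := by
    rw [mul_left_comm, ← Real.exp_add]
    refine mul_le_mul_of_nonneg_left (Real.exp_le_exp.2 ?_) hq
    have h1 : p * (Real.exp 1 - 1) * ((Finset.univ.filter (· ≠ k)).card : ℝ) ≤ p * 2 * n := by
      gcongr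
      linarith
    linarith
  have g2 := (mul_le_mul_of_nonneg_left e2 (Real.exp_pos (p * (k : ℕ) / 4)).le).trans (f _)
  have g3 := (mul_le_mul_of_nonneg_left e3
    (Real.exp_pos (p * ((x k).rev : ℕ) / 4)).le).trans (f _)
  have g4 := (mul_le_mul_of_nonneg_left e4 (Real.exp_pos (-(3 * p * n))).le).trans f4
  have g1 := mul_le_mul_of_nonneg_left e1 (Real.exp_pos _ : 0 < u).le
  have g1' : u * ((1 - p) * Real.exp (p * (Real.exp 0 - 1) *
      (Finset.univ.filter fun _ : Fin n => False).card)) = (1 - p) * u := by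
    simp [mul_comm]
  rw [g1'] at g1
  rw [mul_add, mul_add, mul_add]
  refine le_trans ?_ (add_le_add (add_le_add (add_le_add g1 g2) g3) g4)
  simp only [Finset.mul_sum]
  rw [← Finset.sum_add_distrib, ← Finset.sum_add_distrib, ← Finset.sum_add_distrib]
  refine Finset.sum_le_sum fun S _ => ?_
  simp only [mul_left_comm _ (markProb p S), ← mul_add]
  refine mul_le_mul_of_nonneg_left ?_ (markProb_nonneg hp S)
  split_ifs with h
  · simp
  · have hS : S.filter (· ≠ k) = S :=
      Finset.filter_true_of_mem fun i hi e => h (e ▸ hi)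
    have key := exp_neg_mul_div_le (p := p) (N := n) (a := (k : ℕ)) (b := ((x k).rev : ℕ))
      (s := (S.filter (· < k)).card) (t := (S.filter (x k < x ·)).card) (m := S.card)
      hp0 hn (by positivity) (by positivity) (by positivity) (by positivity)
      (by exact_mod_cast Finset.card_filter_le _ _)
    rw [hS, ← Real.exp_add, ← Real.exp_add, ← Real.exp_add, ← Real.exp_add]
    refine key.trans_eq ?_
    ring_nf

/-! ### Summing over the positions -/

theorem sum_exp_neg_mul_le {γ : ℝ} (hγ : 0 < γ) (n : ℕ) :
    ∑ k : Fin n, Real.exp (-(γ * (k : ℕ))) ≤ 1 + 1 / γ := by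
  have hr : Real.exp (-γ) ≤ (1 + γ)⁻¹ := by
    rw [Real.exp_neg]
    exact inv_anti₀ (by positivity) (by linarith [Real.add_one_le_exp γ])
  have hγ1 : 1 - (1 + γ)⁻¹ = γ / (1 + γ) := by field_simp; ring
  have hpos : 0 < γ / (1 + γ) := by positivity
  rw [Fin.sum_univ_eq_sum_range fun k : ℕ => Real.exp (-(γ * k))]
  have h : ∀ k : ℕ, Real.exp (-(γ * k)) = Real.exp (-γ) ^ k := fun k => by
    rw [← Real.exp_nat_mul]; congr 1; ring
  simp only [h]
  calc ∑ k ∈ Finset.range n, Real.exp (-γ) ^ k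
      ≤ (1 - Real.exp (-γ))⁻¹ := by
        rw [← one_div, le_div_iff₀ (by linarith), geom_sum_mul_neg]
        exact sub_le_self _ (by positivity)
    _ ≤ (γ / (1 + γ))⁻¹ := inv_anti₀ hpos (by linarith)
    _ = 1 + 1 / γ := by field_simp; ring

theorem sum_exp_neg_mul_sq_le {γ : ℝ} (hγ : 0 < γ) (n : ℕ) :
    ∑ k : Fin n, Real.exp (-(γ * ((k : ℕ) * (k : ℕ)))) ≤ 3 * (1 + 1 / √γ) := by
  have hs : 0 < √γ := Real.sqrt_pos.2 hγ
  have hsq : √γ ^ 2 = γ := Real.sq_sqrt hγ.le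
  calc ∑ k : Fin n, Real.exp (-(γ * ((k : ℕ) * (k : ℕ))))
      ≤ ∑ k : Fin n, 3 * Real.exp (-(√γ * (k : ℕ))) := by
        refine Finset.sum_le_sum fun k _ => ?_
        -- With `u = √γ k`, the inequality `u² ≥ u - 1` reduces the Gaussian sum to a geometric one.
        calc Real.exp (-(γ * ((k : ℕ) * (k : ℕ))))
            ≤ Real.exp (1 + -(√γ * (k : ℕ))) := by
              refine Real.exp_le_exp.2 ?_
              have h1 : γ * ((k : ℕ) * (k : ℕ)) = (√γ * (k : ℕ)) ^ 2 := by rw [mul_pow, hsq]; ring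
              nlinarith [sq_nonneg (√γ * (k : ℕ) - 1), sq_nonneg (√γ * (k : ℕ))]
          _ ≤ _ := by
              rw [Real.exp_add]
              exact mul_le_mul_of_nonneg_right Real.exp_one_lt_three.le (Real.exp_pos _).le
    _ ≤ _ := by
        rw [← Finset.mul_sum]
        exact mul_le_mul_of_nonneg_left (sum_exp_neg_mul_le hs n) (by norm_num)

/-- Since `a b ≥ min(a, b)²`, position and value decouple, and each can be summed alone however the
permutation pairs them. -/
theorem exp_neg_mul_mul_le {γ a b : ℝ} (hγ : 0 ≤ γ) (ha : 0 ≤ a) (hb : 0 ≤ b) :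
    Real.exp (-(γ * (a * b))) ≤ Real.exp (-(γ * (a * a))) + Real.exp (-(γ * (b * b))) := by
  have h1 := Real.exp_pos (-(γ * (a * a)))
  have h2 := Real.exp_pos (-(γ * (b * b)))
  rcases le_total a b with h | h
  · have : Real.exp (-(γ * (a * b))) ≤ Real.exp (-(γ * (a * a))) := by gcongr
    linarith
  · have : Real.exp (-(γ * (a * b))) ≤ Real.exp (-(γ * (b * b))) := by gcongr
    linarith

theorem sum_perm_rev {n : ℕ} (x : Equiv.Perm (Fin n)) (f : ℕ → ℝ) :
    ∑ k : Fin n, f ((x k).rev : ℕ) = ∑ k : Fin n, f (k : ℕ) :=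
  Equiv.sum_comp (x.trans Fin.revPerm) fun k : Fin n => f (k : ℕ)

theorem expectedRecords_le_sqrt {n : ℕ} {p : ℝ} (hp : p ∈ Set.Icc (0 : ℝ) 1) (hp0 : 0 < p)
    (hnp : 1 ≤ n * p) (x : Equiv.Perm (Fin n)) :
    expectedRecords p x ≤ (1 + Real.log n) + 59 * ((1 - p) * √(n / p)) := by
  have hn : (0 : ℝ) < n := by
    by_contra h
    nlinarith [hp.1]
  set R := √(n / p) with hR
  have hRsq : R ^ 2 = n / p := Real.sq_sqrt (by positivity)
  have hR0 : 0 ≤ R := Real.sqrt_nonneg _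
  have hpR : 1 / p ≤ R := by
    refine Real.le_sqrt_of_sq_le ?_
    rw [div_pow, one_pow, div_le_div_iff₀ (by positivity) hp0]
    nlinarith
  have hR1 : 1 ≤ R := le_trans (by rw [le_div_iff₀ hp0]; linarith [hp.2]) hpR
  have hγ : 0 < p / (48 * n) := by positivity
  -- The constant `7` is an upper bound for `√48`.
  have hγR : 1 / √(p / (48 * n)) ≤ 7 * R := by
    rw [one_div, ← Real.sqrt_inv, inv_div]
    refine Real.sqrt_le_iff.2 ⟨by positivity, ?_⟩
    rw [mul_pow, hRsq, mul_div_assoc]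
    have : 0 < n / p := by positivity
    linarith
  have hnR : n * Real.exp (-(p * n)) ≤ R := by
    refine Real.le_sqrt_of_sq_le ?_
    have h1 : 1 ≤ p * n := by linarith
    have h2 : p * n ≤ Real.exp (p * n) := by linarith [Real.add_one_le_exp (p * n)]
    have h3 : p * n ≤ Real.exp (p * n) ^ 2 := by nlinarith
    rw [Real.exp_neg, mul_pow, inv_pow, ← div_eq_mul_inv, div_le_div_iff₀ (by positivity) hp0]
    nlinarith
  refine (expectedRecords_le hp x).trans (add_le_add_right ?_ _)
  refine (Finset.sum_le_sum fun k _ => sum_markProb_unmarked_le hp hp0 x k).trans ?_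
  rw [← Finset.mul_sum, mul_left_comm]
  refine mul_le_mul_of_nonneg_left ?_ (sub_nonneg.2 hp.2)
  rw [Finset.sum_add_distrib, Finset.sum_add_distrib, Finset.sum_add_distrib]
  have s1 : ∑ k : Fin n, Real.exp (-(p / (48 * n) * ((k : ℕ) * ((x k).rev : ℕ)))) ≤
      2 * (3 * (1 + 7 * R)) := by
    refine (Finset.sum_le_sum fun k _ => exp_neg_mul_mul_le hγ.le (Nat.cast_nonneg _)
      (Nat.cast_nonneg _)).trans ?_
    rw [Finset.sum_add_distrib,
      sum_perm_rev x fun j => Real.exp (-(p / (48 * n) * ((j : ℝ) * j)))]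
    linarith [sum_exp_neg_mul_sq_le hγ n]
  have s2 := sum_exp_neg_mul_le (γ := p / 4) (by positivity) n
  have s3 := sum_perm_rev x fun j => Real.exp (-(p / 4 * (j : ℝ)))
  have h4 : 1 / (p / 4) = 4 * (1 / p) := by field_simp
  rw [h4] at s2
  rw [s3, Finset.sum_const, Finset.card_univ, Fintype.card_fin, nsmul_eq_mul]
  -- The total is `6 + 42 R` from the Gaussian sums, `2 (1 + 4 R)` from the geometric ones and `R`
  -- from `hnR`; `1 ≤ R` turns this into `59 R`.
  linarith

end Records

/-! ### The asymptotic bound -/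

theorem corollary1 (c : ℝ) (hc : 0 < c) :
    ∃ C : ℝ, 0 < C ∧ ∀ p : ℕ → ℝ, (∀ n, p n ∈ Set.Icc (0 : ℝ) 1) →
      Asymptotics.IsLittleO Filter.atTop (fun n : ℕ => (n : ℝ)⁻¹) p →
      (∀ᶠ n : ℕ in Filter.atTop, c * (n : ℝ) ^ (-(1 / 2) : ℝ) * Real.log n ≤ 1 - p n) →
      Asymptotics.IsBigOWith C Filter.atTop
        (fun n : ℕ => Records.maxExpectedRecords n (p n))
        (fun n : ℕ => (1 - p n) * Real.sqrt ((n : ℝ) / p n)) := by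
  -- The term `2 / c` absorbs the marked records: `1 + log n ≤ 2 log n` for `n ≥ 3`, and `c log n ≤
  -- (1 - p) √(n / p)`.
  refine ⟨2 / c + 59, by positivity, fun p hp hlit hlow => ?_⟩
  rw [Asymptotics.isBigOWith_iff]
  -- Only `n p ≥ 1` is needed from `p ≫ 1 / n`, hence the little-o bound with constant `1`.
  filter_upwards [hlit.bound one_pos, hlow, Filter.eventually_ge_atTop 3] with n hn1 hn2 hn3
  have hn : (0 : ℝ) < n := by positivity
  have hpn := hp n
  rw [one_mul, Real.norm_of_nonneg (by positivity), Real.norm_of_nonneg hpn.1] at hn1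
  have hp0 : 0 < p n := lt_of_lt_of_le (by positivity) hn1
  have hnp : 1 ≤ n * p n := by rwa [inv_le_iff_one_le_mul₀' hn] at hn1
  have hlog : 1 ≤ Real.log n := by
    rw [Real.le_log_iff_exp_le hn]
    exact Real.exp_one_lt_three.le.trans (by exact_mod_cast hn3)
  have hrhs : 0 ≤ (1 - p n) * √(n / p n) :=
    mul_nonneg (sub_nonneg.2 hpn.2) (Real.sqrt_nonneg _)
  have hclog : c * Real.log n ≤ (1 - p n) * √(n / p n) := by
    have hsqrt : √(n : ℝ) ≤ √(n / p n) :=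
      Real.sqrt_le_sqrt (by rw [le_div_iff₀ hp0]; nlinarith [hpn.2])
    have hpow : (n : ℝ) ^ (-(1 / 2) : ℝ) * √(n : ℝ) = 1 := by
      rw [Real.sqrt_eq_rpow, ← Real.rpow_add hn]
      norm_num
    calc c * Real.log n = c * (n : ℝ) ^ (-(1 / 2) : ℝ) * Real.log n * √(n : ℝ) := by
          linear_combination (-(c * Real.log n)) * hpow
      _ ≤ _ := mul_le_mul hn2 hsqrt (Real.sqrt_nonneg _) (sub_nonneg.2 hpn.2)
  have hlogle : Real.log n ≤ (1 - p n) * √(n / p n) / c := by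
    rw [le_div_iff₀ hc]; linarith
  have hle : Records.maxExpectedRecords n (p n) ≤ (2 / c + 59) * ((1 - p n) * √(n / p n)) := by
    refine Finset.sup'_le _ _ fun x _ =>
      (Records.expectedRecords_le_sqrt hpn hp0 hnp x).trans ?_
    have : (2 / c + 59) * ((1 - p n) * √(n / p n)) =
        2 * ((1 - p n) * √(n / p n) / c) + 59 * ((1 - p n) * √(n / p n)) := by ring
    linarith
  have hnonneg : 0 ≤ Records.maxExpectedRecords n (p n) :=
    (Records.expectedRecords_nonneg hpn 1).trans
      (Finset.le_sup' (fun x => Records.expectedRecords (p n) x) (Finset.mem_univ 1))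
  rwa [Real.norm_of_nonneg hnonneg, Real.norm_of_nonneg hrhs]
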